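/- Fix an integer $m\ge 1$ and a real $c>0$. For each $n\ge 1$ let $n$ bins be given, each bin $i$ having a rank $r_i\in\{1,\dots,m\}$; let $n_r$ be the number of bins of rank $r$ and $g_r=n_r/n$ (the ranks, and hence the $g_r$, may depend on $n$). Let $G(n,n,p)$ be the random bipartite graph between the $n$ bins and $n$ balls in which each of the $n^2$ possible edges is present independently with probability $p=c/n$ (for $n\ge c$). The balls arrive one at a time; when a ball arrives, its edges are revealed, and the vertex-weighted greedy algorithm matches it to a bin of smallest rank among its currently unmatched neighbors, and drops it if there are none. Ties between bins of the same rank are broken by an arbitrary rule that may depend on the edges revealed so far and on randomness independent of the graph. Let $\mu^r(t)$ be the number of bins of rank $r$ that are matched after the first $t$ balls have been processed; in particular $\mu^r(n)$ is the number of bins of rank $r$ in the final matching. Then asymptotically almost surely (with probability $1-o(1)$ as $n\to\infty$), for all $1\le r\le m$ and all $\tau\in\{0,\tfrac1n,\tfrac2n,\dots,1\}$, $$\frac{\mu^r(\tau n)}{n}=g_r-\frac1c\log\left(\frac{1+e^{-c\tau}\left(e^{c\sum_{k=1}^{r}g_k}-1\right)}{1+e^{-c\tau}\left(e^{c\sum_{k=1}^{r-1}g_k}-1\right)}\right)+o(1),$$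 uniformly in $r$ and $\tau$; that is, for every $\varepsilon>0$, the probability that the two sides without the $o(1)$ differ by at most $\varepsilon$ for all these $r$ and $\tau$ simultaneously tends to $1$. For $\tau=1$ this gives the number of matched bins of rank $r$ in the final matching. -/

import Mathlib

open MeasureTheory ProbabilityTheory Filter Topology

/-- The law of the random bipartite graph `G(n,n,p)`. A graph is its edge set, a set of pairs
(bin, ball), and each of the `n * n` pairs is an edge independently with probability `p`
(the real number `p` is clamped to `[0,1]`). -/
noncomputable def randomBipartiteGraph (n : ℕ) (p : ℝ) : Measure (Set (Fin n × Fin n)) :=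
  setBernoulli Set.univ (Set.projIcc (0 : ℝ) 1 zero_le_one p)

open Classical in
/-- The set `N(j)` of bins adjacent to the ball `j`. -/
noncomputable def neighborBins {n : ℕ} (E : Set (Fin n × Fin n)) (j : Fin n) :
    Finset (Fin n) :=
  Finset.univ.filter fun i => (i, j) ∈ E

/-- What has been revealed once the first `t` balls have arrived: the list of the neighborhoods
of these balls, the most recent ball first. The balls arrive in the order `0, 1, 2, …`. -/
noncomputable def history {n : ℕ} (E : Set (Fin n × Fin n)) (t : ℕ) : List (Finset (Fin n)) :=
  (((List.finRange n).take t).map (neighborBins E)).reverse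

/-- The bins of smallest rank among the bins in `U`. -/
def minRankBins {n m : ℕ} (rank : Fin n → Fin m) (U : Finset (Fin n)) : Finset (Fin n) :=
  U.filter fun i => ∀ k ∈ U, rank i ≤ rank k

theorem minRankBins_nonempty {n m : ℕ} (rank : Fin n → Fin m) {U : Finset (Fin n)}
    (hU : U.Nonempty) : (minRankBins rank U).Nonempty := by
  obtain ⟨i, hi, h⟩ := U.exists_min_image rank hU
  exact ⟨i, Finset.mem_filter.2 ⟨hi, h⟩⟩

/-- A (possibly randomized) online rule for choosing one bin among several equally good ones.
The choice may depend on a random seed `ω`, on the neighborhoods of all balls that have arrived so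
far (the current one included), and on the nonempty set `A` of bins to choose from. -/
structure TieBreaking (Ω : Type*) [MeasurableSpace Ω] (n : ℕ) where
  pick : Ω → List (Finset (Fin n)) → (A : Finset (Fin n)) → A.Nonempty → Fin n
  pick_mem : ∀ ω h A hA, pick ω h A hA ∈ A
  measurable_pick : ∀ h A hA, Measurable fun ω => pick ω h A hA

/-- The set of bins matched by the vertex-weighted greedy algorithm when the arrived balls have the
listed neighborhoods (most recent ball first): an arriving ball with neighborhood `N` is matched to
a bin of smallest rank among its unmatched neighbors, and is dropped if it has none. -/
def matchedBins {n m : ℕ} (rank : Fin n → Fin m) {Ω : Type*} [MeasurableSpace Ω]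
    (σ : TieBreaking Ω n) (ω : Ω) : List (Finset (Fin n)) → Finset (Fin n)
  | [] => ∅
  | N :: past =>
    let M := matchedBins rank σ ω past
    if h : (N \ M).Nonempty then
      insert (σ.pick ω (N :: past) (minRankBins rank (N \ M)) (minRankBins_nonempty rank h)) M
    else M

/-- The number of bins of rank `r` that the vertex-weighted greedy algorithm has matched on the
graph `E` once the first `t` balls have been processed. -/
noncomputable def matchedCount {n m : ℕ} (rank : Fin n → Fin m) {Ω : Type*} [MeasurableSpace Ω]
    (σ : TieBreaking Ω n) (ω : Ω) (E : Set (Fin n × Fin n)) (t : ℕ) (r : Fin m) : ℕ :=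
  ((matchedBins rank σ ω (history E t)).filter fun i => rank i = r).card

/-- The fraction `g_r` of the bins that have rank `r`. -/
noncomputable def rankFraction {n m : ℕ} (rank : Fin n → Fin m) (r : Fin m) : ℝ :=
  ((Finset.univ.filter fun i => rank i = r).card : ℝ) / n

/-- The function `z_r(τ)`, for ranks that occur with the fractions `g`. -/
noncomputable def limitFraction {m : ℕ} (c : ℝ) (g : Fin m → ℝ) (r : Fin m) (τ : ℝ) : ℝ :=
  g r - 1 / c * Real.log
    ((1 + Real.exp (-c * τ) * (Real.exp (c * ∑ k ∈ Finset.Iic r, g k) - 1)) /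
      (1 + Real.exp (-c * τ) * (Real.exp (c * ∑ k ∈ Finset.Iio r, g k) - 1)))

/-! Fix the seed and let `X` be the number of unmatched bins whose rank lies in a down-closed set
`S`. Greedy prefers small ranks, so `X` drops by exactly one when the new ball has an unmatched
neighbor with rank in `S`, and otherwise stays put. Given the past, it stays put with probability
`(1 - p) ^ X`, whatever the tie-breaking rule.

With `s = (1 - p)⁻¹` this makes `s ^ t * (s ^ X - 1)` an exact martingale
(`integral_unmatchedMartingale_cons_sub`), so no differential equation method is needed. For `p = c
/ n` its increments are `O(1/n)`, so Kolmogorov's maximal inequality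
(`measureReal_exists_deviation_le`) keeps it within `δ` of its initial value at all times, except
with probability `O(1/n)`.

Writing `s ^ k = exp (L * (k / n))` with `L = -n log (1 - p) → c`, near-constancy reads
`e^{Lτ}(e^{Lx} - 1) ≈ e^{LG} - 1`, where `x = X / n` and `G` is the fraction of bins with rank in
`S`. Solving for `x` (`abs_sub_log_le`) and subtracting the cases `S = Iio r` and `S = Iic r` gives
the formula for rank `r`. The bounds are uniform in the seed, which is integrated out last. -/

/-! ### Histories and independence of edges. -/

theorem history_succ {n : ℕ} (E : Set (Fin n × Fin n)) (j : Fin n) :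
    history E (j + 1) = neighborBins E j :: history E j := by
  have h : (List.finRange n).take (j + 1) = (List.finRange n).take j ++ [j] := by
    rw [List.take_add_one]
    simp
  simp [history, h]

theorem history_zero {n : ℕ} (E : Set (Fin n × Fin n)) : history E 0 = [] := by
  simp [history]

theorem length_history {n : ℕ} (E : Set (Fin n × Fin n)) {t : ℕ} (ht : t ≤ n) :
    (history E t).length = t := by
  simp [history, ht]

/-- The law of the membership of a single element under `setBernoulli Set.univ p`. -/
theorem map_mem_setBernoulli_univ {ι : Type*} (p : unitInterval) (e : ι) :
    (setBernoulli (Set.univ : Set ι) p).map (fun E => e ∈ E) =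
      unitInterval.toNNReal p • Measure.dirac True +
        unitInterval.toNNReal (unitInterval.symm p) • Measure.dirac False := by
  rw [setBernoulli_eq_map, Measure.map_map (by fun_prop) (by fun_prop)]
  have := Measure.infinitePi_map_eval (fun i : ι =>
    unitInterval.toNNReal p • Measure.dirac (i ∈ (Set.univ : Set ι)) +
      unitInterval.toNNReal (unitInterval.symm p) • Measure.dirac False) e
  simp only [Set.mem_univ] at this ⊢
  exact this

theorem iIndepFun_mem_setBernoulli_univ {ι : Type*} (p : unitInterval) :
    iIndepFun (fun (e : ι) (E : Set ι) => e ∈ E) (setBernoulli (Set.univ : Set ι) p) := by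
  rw [iIndepFun_iff_map_fun_eq_infinitePi_map (by fun_prop)]
  simp_rw [map_mem_setBernoulli_univ]
  rw [setBernoulli_eq_map, Measure.map_map (by fun_prop) (by fun_prop)]
  simp only [Set.mem_univ]
  exact Measure.map_id

instance isProbabilityMeasure_randomBipartiteGraph (n : ℕ) (p : ℝ) :
    IsProbabilityMeasure (randomBipartiteGraph n p) := by
  unfold randomBipartiteGraph; infer_instance

theorem iIndepFun_edge (n : ℕ) (p : ℝ) :
    iIndepFun (fun (e : Fin n × Fin n) E => e ∈ E) (randomBipartiteGraph n p) :=
  iIndepFun_mem_setBernoulli_univ _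

theorem randomBipartiteGraph_notMem {n : ℕ} {p : ℝ} (hp : p ∈ Set.Icc (0 : ℝ) 1)
    (e : Fin n × Fin n) :
    (randomBipartiteGraph n p) {E | e ∉ E} = ENNReal.ofReal (1 - p) := by
  have h : (randomBipartiteGraph n p) {E | e ∉ E} =
      (randomBipartiteGraph n p).map (fun E => e ∈ E) {False} := by
    rw [Measure.map_apply (by fun_prop) (MeasurableSet.singleton _)]
    congr 1; ext E; simp
  rw [h, randomBipartiteGraph, map_mem_setBernoulli_univ, Set.projIcc_of_mem _ hp]
  rw [Measure.add_apply, Measure.coe_nnreal_smul_apply, Measure.coe_nnreal_smul_apply,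
    ENNReal.ofReal, Real.toNNReal_of_nonneg (sub_nonneg.2 hp.2)]
  simp only [Measure.dirac_apply' _ (MeasurableSet.singleton False), Set.mem_singleton_iff,
    Set.indicator, if_true, if_false, mul_zero, zero_add, Pi.one_apply, mul_one,
    eq_iff_iff, iff_false, not_true_eq_false]
  rfl

theorem measureReal_disjoint_neighborBins {n : ℕ} {p : ℝ} (hp : p ∈ Set.Icc (0 : ℝ) 1)
    (j : Fin n) (U : Finset (Fin n)) :
    (randomBipartiteGraph n p).real {E | Disjoint (neighborBins E j) U} = (1 - p) ^ U.card := by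
  have hset : {E : Set (Fin n × Fin n) | Disjoint (neighborBins E j) U} =
      ⋂ e ∈ U.image (fun i => (i, j)), {E | e ∉ E} := by
    ext E
    simp only [Finset.disjoint_right, neighborBins, Set.mem_ofPred_eq]
    simp
  have hind := (iIndepFun_edge n p).meas_biInter (S := U.image (fun i => (i, j)))
    (s := fun e => {E | e ∉ E}) (fun e _ => ⟨{False}, MeasurableSet.singleton _, by ext E; simp⟩)
  rw [Measure.real, hset, hind, Finset.prod_congr rfl
    (fun e _ => randomBipartiteGraph_notMem hp e), Finset.prod_const,
    Finset.card_image_of_injective _ (fun a b h => (Prod.ext_iff.1 h).1), ENNReal.toReal_pow,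
    ENNReal.toReal_ofReal (by linarith [hp.2])]

/-- The neighborhood of a ball is independent of the neighborhoods of the earlier balls. -/
theorem indepFun_history_neighborBins {n : ℕ} (p : ℝ) (j : Fin n)
    [MeasurableSpace (List (Finset (Fin n)))] [MeasurableSpace (Finset (Fin n))] :
    IndepFun (fun E => history E j) (fun E => neighborBins E j) (randomBipartiteGraph n p) := by
  classical
  let S : Finset (Fin n × Fin n) := Finset.univ.filter fun e => e.2 < j
  let T : Finset (Fin n × Fin n) := Finset.univ.filter fun e => e.2 = j
  have hST : Disjoint S T := by
    rw [Finset.disjoint_left]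
    intro e h1 h2
    simp only [S, T, Finset.mem_filter] at h1 h2
    exact h1.2.ne h2.2
  have h := (iIndepFun_edge n p).indepFun_finset S T hST (by fun_prop)
  -- Both sides are functions of disjoint blocks of edges: `f` and `g` rebuild a graph from the
  -- edges at earlier balls, respectively at `j`, with all other edges absent.
  let f : (S → Prop) → List (Finset (Fin n)) := fun u =>
    history {e | ∃ he : e ∈ S, u ⟨e, he⟩} j
  let g : (T → Prop) → Finset (Fin n) := fun u => neighborBins {e | ∃ he : e ∈ T, u ⟨e, he⟩} j
  have h2 := h.comp (φ := f) (ψ := g) (Measurable.of_discrete) (Measurable.of_discrete)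
  convert h2 using 1
  · ext1 E
    simp only [f, history, Function.comp]
    congr 1
    apply List.map_congr_left
    intro k hk
    have hk' : k < j := by
      obtain ⟨i, hi, rfl⟩ := List.mem_take_iff_getElem.1 hk
      simp only [List.getElem_finRange, Fin.lt_def]
      simp only [List.length_finRange, lt_inf_iff] at hi
      exact hi.1
    ext i
    simp [neighborBins, S, hk']
  · ext1 E
    ext i
    simp [g, neighborBins, T]

/-! ### A maximal inequality for functions of the history. -/

/-- Fubini for the product law of `(X, Y)`. It replaces conditioning on the past: a bound with the
past frozen at each value `a` may be integrated. -/
theorem integral_le_of_indepFun {Ω α β : Type*} [MeasurableSpace Ω] [Finite Ω]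
    [MeasurableSingletonClass Ω] {μ : Measure Ω} [IsProbabilityMeasure μ]
    [Countable α] [Countable β] {X : Ω → α} {Y : Ω → β}
    (hXY : @IndepFun _ _ _ _ ⊤ ⊤ X Y μ)
    (φ : α → β → ℝ) (ψ : α → ℝ) (h : ∀ a, ∫ ω, φ a (Y ω) ∂μ ≤ ψ a) :
    ∫ ω, φ (X ω) (Y ω) ∂μ ≤ ∫ ω, ψ (X ω) ∂μ := by
  let : MeasurableSpace α := ⊤
  let : MeasurableSpace β := ⊤
  have hX : Measurable X := Measurable.of_discrete
  have hY : Measurable Y := Measurable.of_discrete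
  have hmap := (indepFun_iff_map_prod_eq_prod_map_map hX.aemeasurable hY.aemeasurable).1 hXY
  have hφ : Measurable (fun z : α × β => φ z.1 z.2) := Measurable.of_discrete
  have hψ : Measurable ψ := Measurable.of_discrete
  have := Measure.isProbabilityMeasure_map (μ := μ) hX.aemeasurable
  have := Measure.isProbabilityMeasure_map (μ := μ) hY.aemeasurable
  have hint : Integrable (fun z : α × β => φ z.1 z.2) ((μ.map X).prod (μ.map Y)) := by
    rw [← hmap, integrable_map_measure hφ.aestronglyMeasurable (hX.prodMk hY).aemeasurable]
    exact Integrable.of_finite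
  have hintψ : Integrable ψ (μ.map X) := by
    rw [integrable_map_measure hψ.aestronglyMeasurable hX.aemeasurable]
    exact Integrable.of_finite
  calc ∫ ω, φ (X ω) (Y ω) ∂μ
      = ∫ z, φ z.1 z.2 ∂(μ.map fun ω => (X ω, Y ω)) := by
        rw [integral_map (hX.prodMk hY).aemeasurable hφ.aestronglyMeasurable]
    _ = ∫ a, ∫ b, φ a b ∂(μ.map Y) ∂(μ.map X) := by rw [hmap, integral_prod _ hint]
    _ ≤ ∫ a, ψ a ∂(μ.map X) := by
        refine integral_mono hint.integral_prod_left hintψ fun a => ?_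
        rw [integral_map hY.aemeasurable Measurable.of_discrete.aestronglyMeasurable]
        exact h a
    _ = ∫ ω, ψ (X ω) ∂μ := integral_map hX.aemeasurable hψ.aestronglyMeasurable

/-- The deviation of `M` from its initial value, frozen when it first exceeds `δ`. -/
noncomputable def stoppedDeviation {α : Type*} (M : List α → ℝ) (δ : ℝ) : List α → ℝ
  | [] => 0
  | a :: h =>
    if δ < |stoppedDeviation M δ h| then stoppedDeviation M δ h else M (a :: h) - M []

theorem stoppedDeviation_eq {α : Type*} (M : List α → ℝ) (δ : ℝ) (h : List α)
    (hh : ¬ δ < |stoppedDeviation M δ h|) : stoppedDeviation M δ h = M h - M [] := by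
  cases h with
  | nil => simp [stoppedDeviation]
  | cons a h =>
    rw [stoppedDeviation] at hh ⊢
    split_ifs with h1
    · rw [if_pos h1] at hh; exact absurd h1 hh
    · rfl

/-- Martingale increments are orthogonal to the past, so each step adds at most `K ^ 2` to the
second moment, and a frozen step adds nothing. -/
theorem integral_stoppedDeviation_sq_le {n : ℕ} (p : ℝ) (M : List (Finset (Fin n)) → ℝ)
    (δ K : ℝ)
    (hmart : ∀ (j : Fin n) (h : List (Finset (Fin n))), h.length = j →
      ∫ E, (M (neighborBins E j :: h) - M h) ∂(randomBipartiteGraph n p) = 0)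
    (hK : ∀ (N : Finset (Fin n)) (h : List (Finset (Fin n))), h.length < n →
      |M (N :: h) - M h| ≤ K) (t : ℕ) (ht : t ≤ n) :
    ∫ E, stoppedDeviation M δ (history E t) ^ 2 ∂(randomBipartiteGraph n p) ≤ t * K ^ 2 := by
  induction t with
  | zero => simp [history_zero, stoppedDeviation]
  | succ t ih =>
    set μ := randomBipartiteGraph n p
    let j : Fin n := ⟨t, ht⟩
    have hstep := integral_le_of_indepFun (μ := μ)
      (@indepFun_history_neighborBins n p j ⊤ ⊤)
      -- The guard is needed because the bound must hold for every list, while the martingale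
      -- property is available only for lists of length `t`.
      (fun h N => if h.length = t then stoppedDeviation M δ (N :: h) ^ 2 else 0)
      (fun h => if h.length = t then stoppedDeviation M δ h ^ 2 + K ^ 2 else 0) (by
        intro h
        by_cases hl : h.length = t
        swap
        · simp [hl]
        simp only [hl, if_true, stoppedDeviation]
        by_cases hd : δ < |stoppedDeviation M δ h|
        · simp only [hd, if_true]
          rw [integral_const]
          simp [sq_nonneg]
        · simp only [hd, if_false]
          have hD := stoppedDeviation_eq M δ h hd
          have hexp : ∀ E : Set (Fin n × Fin n), (M (neighborBins E j :: h) - M []) ^ 2 =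
              (stoppedDeviation M δ h ^ 2 + (2 * stoppedDeviation M δ h) *
                (M (neighborBins E j :: h) - M h)) + (M (neighborBins E j :: h) - M h) ^ 2 := by
            intro E; rw [hD]; ring
          simp_rw [hexp]
          rw [integral_add Integrable.of_finite Integrable.of_finite,
            integral_add Integrable.of_finite Integrable.of_finite, integral_const_mul,
            hmart j h hl]
          have : ∫ E, (M (neighborBins E j :: h) - M h) ^ 2 ∂μ ≤ ∫ _, K ^ 2 ∂μ :=
            integral_mono Integrable.of_finite Integrable.of_finite fun E =>
              sq_le_sq' (abs_le.1 (hK _ h (by omega))).1 (abs_le.1 (hK _ h (by omega))).2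
          simp at this ⊢
          exact this)
    have hlen : ∀ E : Set (Fin n × Fin n), (history E j).length = t :=
      fun E => length_history E (by omega)
    simp only [hlen, if_true] at hstep
    have hs : ∀ E : Set (Fin n × Fin n), history E (t + 1) = neighborBins E j :: history E j :=
      fun E => history_succ E j
    simp_rw [hs]
    refine hstep.trans ?_
    rw [integral_add Integrable.of_finite Integrable.of_finite]
    have := ih (by omega)
    simp only [integral_const, probReal_univ, smul_eq_mul, one_mul, j]
    push_cast
    linarith

/-- Kolmogorov's maximal inequality for a martingale that is a function of the history of the
random bipartite graph. -/
theorem measureReal_exists_deviation_le {n : ℕ} (p : ℝ) (M : List (Finset (Fin n)) → ℝ)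
    {δ K : ℝ} (hδ : 0 < δ)
    (hmart : ∀ (j : Fin n) (h : List (Finset (Fin n))), h.length = j →
      ∫ E, (M (neighborBins E j :: h) - M h) ∂(randomBipartiteGraph n p) = 0)
    (hK : ∀ (N : Finset (Fin n)) (h : List (Finset (Fin n))), h.length < n →
      |M (N :: h) - M h| ≤ K) :
    (randomBipartiteGraph n p).real {E | ∃ t ≤ n, δ < |M (history E t) - M []|} ≤
      n * K ^ 2 / δ ^ 2 := by
  have hsub : {E : Set (Fin n × Fin n) | ∃ t ≤ n, δ < |M (history E t) - M []|} ⊆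
      {E | δ ^ 2 ≤ stoppedDeviation M δ (history E n) ^ 2} := by
    rintro E ⟨t, ht, hd⟩
    have h0 : δ < |stoppedDeviation M δ (history E t)| := by
      by_contra hc
      exact hc (by rwa [stoppedDeviation_eq M δ _ hc])
    -- Freezing carries an exceedance on to time `n`, so Markov's inequality for the square at that
    -- single time suffices.
    have hmono : ∀ k, t ≤ k → k ≤ n → δ < |stoppedDeviation M δ (history E k)| := by
      intro k hk
      induction k, hk using Nat.le_induction with
      | base => exact fun _ => h0
      | succ k hk ih =>
        intro hkn
        have h1 := ih (by omega)
        rw [show history E (k + 1) = _ from history_succ E ⟨k, hkn⟩, stoppedDeviation, if_pos h1]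
        exact h1
    have h1 := hmono n ht le_rfl
    simp only [Set.mem_ofPred_eq]
    rw [← sq_abs (stoppedDeviation M δ (history E n))]
    gcongr
  refine (measureReal_mono hsub).trans ?_
  have hm := mul_meas_ge_le_integral_of_nonneg (μ := randomBipartiteGraph n p)
    (f := fun E => stoppedDeviation M δ (history E n) ^ 2) (ae_of_all _ fun _ => sq_nonneg _)
    Integrable.of_finite (δ ^ 2)
  rw [le_div_iff₀ (by positivity), mul_comm]
  exact hm.trans (integral_stoppedDeviation_sq_le p M δ K hmart hK n le_rfl)

/-! ### Greedy dynamics and the exact martingale. -/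

section Matching

variable {n m : ℕ} (rank : Fin n → Fin m) {Ω : Type*} [MeasurableSpace Ω] (σ : TieBreaking Ω n)
  (ω : Ω)

/-- The bins whose rank lies in `S`. -/
def binsWithRank (S : Finset (Fin m)) : Finset (Fin n) :=
  Finset.univ.filter fun i => rank i ∈ S

/-- The bins with rank in `S` that are still unmatched after the given history. -/
def unmatchedBins (S : Finset (Fin m)) (h : List (Finset (Fin n))) : Finset (Fin n) :=
  binsWithRank rank S \ matchedBins rank σ ω h

theorem mem_unmatchedBins {S : Finset (Fin m)} {h : List (Finset (Fin n))} {i : Fin n} :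
    i ∈ unmatchedBins rank σ ω S h ↔ rank i ∈ S ∧ i ∉ matchedBins rank σ ω h := by
  simp [unmatchedBins, binsWithRank]

theorem unmatchedBins_nil (S : Finset (Fin m)) :
    unmatchedBins rank σ ω S [] = binsWithRank rank S := by
  simp [unmatchedBins, matchedBins]

theorem unmatchedBins_cons_of_disjoint {S : Finset (Fin m)} {N : Finset (Fin n)}
    {h : List (Finset (Fin n))} (hN : Disjoint N (unmatchedBins rank σ ω S h)) :
    unmatchedBins rank σ ω S (N :: h) = unmatchedBins rank σ ω S h := by
  by_cases hne : (N \ matchedBins rank σ ω h).Nonempty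
  · set b := σ.pick ω (N :: h) _ (minRankBins_nonempty rank hne) with hb
    have hmem : b ∈ minRankBins rank (N \ matchedBins rank σ ω h) := σ.pick_mem _ _ _ _
    have hbN := (Finset.mem_filter.1 hmem).1
    rw [Finset.mem_sdiff] at hbN
    have hbU : b ∉ unmatchedBins rank σ ω S h := Finset.disjoint_left.1 hN hbN.1
    ext i
    simp only [mem_unmatchedBins, matchedBins, hne, dif_pos, ← hb, Finset.mem_insert] at hbU ⊢
    constructor
    · tauto
    · rintro ⟨h1, h2⟩
      refine ⟨h1, ?_⟩
      rintro (rfl | h3)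
      · exact hbU ⟨h1, h2⟩
      · exact h2 h3
  · ext i
    simp [mem_unmatchedBins, matchedBins, hne]

/-- A smallest-rank candidate ranks no higher than the available neighbor in `S`, so down-closedness
puts the chosen bin in `S`, whichever way ties are broken. -/
theorem card_unmatchedBins_cons_of_not_disjoint {S : Finset (Fin m)}
    (hS : ∀ a ∈ S, ∀ b ≤ a, b ∈ S) {N : Finset (Fin n)}
    {h : List (Finset (Fin n))} (hN : ¬ Disjoint N (unmatchedBins rank σ ω S h)) :
    (unmatchedBins rank σ ω S (N :: h)).card + 1 = (unmatchedBins rank σ ω S h).card := by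
  obtain ⟨i, hiN, hiU⟩ := Finset.not_disjoint_iff.1 hN
  rw [mem_unmatchedBins] at hiU
  have hi : i ∈ N \ matchedBins rank σ ω h := Finset.mem_sdiff.2 ⟨hiN, hiU.2⟩
  have hne : (N \ matchedBins rank σ ω h).Nonempty := ⟨i, hi⟩
  set b := σ.pick ω (N :: h) _ (minRankBins_nonempty rank hne) with hb
  have hmem : b ∈ minRankBins rank (N \ matchedBins rank σ ω h) := σ.pick_mem _ _ _ _
  have hbmin := Finset.mem_filter.1 hmem
  have hbS : rank b ∈ S := hS _ hiU.1 _ (hbmin.2 i hi)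
  have hbU : b ∈ unmatchedBins rank σ ω S h :=
    (mem_unmatchedBins rank σ ω).2 ⟨hbS, (Finset.mem_sdiff.1 hbmin.1).2⟩
  have herase : unmatchedBins rank σ ω S (N :: h) = (unmatchedBins rank σ ω S h).erase b := by
    ext k
    simp only [mem_unmatchedBins, matchedBins, hne, dif_pos, ← hb, Finset.mem_insert,
      Finset.mem_erase]
    tauto
  rw [herase, Finset.card_erase_add_one hbU]

theorem card_unmatchedBins_le (S : Finset (Fin m)) (h : List (Finset (Fin n))) :
    (unmatchedBins rank σ ω S h).card ≤ n :=
  (Finset.card_le_univ _).trans_eq (Fintype.card_fin n)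

/-- The exact martingale `s ^ t * (s ^ X - 1)`, where `t` is the number of processed balls and `X`
the number of unmatched bins with rank in `S`. -/
noncomputable def unmatchedMartingale (S : Finset (Fin m)) (s : ℝ) (h : List (Finset (Fin n))) :
    ℝ :=
  s ^ h.length * (s ^ (unmatchedBins rank σ ω S h).card - 1)

open Classical in
theorem unmatchedMartingale_cons_sub {S : Finset (Fin m)} (hS : ∀ a ∈ S, ∀ b ≤ a, b ∈ S)
    (s : ℝ) (N : Finset (Fin n)) (h : List (Finset (Fin n))) :
    unmatchedMartingale rank σ ω S s (N :: h) - unmatchedMartingale rank σ ω S s h =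
      if Disjoint N (unmatchedBins rank σ ω S h) then
        s ^ h.length * (s - 1) * (s ^ (unmatchedBins rank σ ω S h).card - 1)
      else s ^ h.length * (1 - s) := by
  unfold unmatchedMartingale
  split_ifs with hN
  · rw [unmatchedBins_cons_of_disjoint rank σ ω hN, List.length_cons]
    ring
  · rw [← card_unmatchedBins_cons_of_not_disjoint rank σ ω hS hN, List.length_cons]
    ring

theorem abs_unmatchedMartingale_cons_sub_le {S : Finset (Fin m)}
    (hS : ∀ a ∈ S, ∀ b ≤ a, b ∈ S) {s : ℝ} (hs : 1 ≤ s) (N : Finset (Fin n))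
    (h : List (Finset (Fin n))) (hl : h.length < n) :
    |unmatchedMartingale rank σ ω S s (N :: h) - unmatchedMartingale rank σ ω S s h| ≤
      (s ^ n) ^ 2 * (s - 1) := by
  rw [unmatchedMartingale_cons_sub rank σ ω hS]
  have h1 : s ^ h.length ≤ s ^ n := pow_le_pow_right₀ hs hl.le
  have h2 : s ^ (unmatchedBins rank σ ω S h).card ≤ s ^ n :=
    pow_le_pow_right₀ hs (card_unmatchedBins_le rank σ ω S h)
  have h3 : 1 ≤ s ^ (unmatchedBins rank σ ω S h).card := one_le_pow₀ hs
  have h4 : 1 ≤ s ^ n := one_le_pow₀ hs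
  have h5 : 0 ≤ s ^ h.length := by positivity
  have h6 : 0 ≤ s - 1 := by linarith
  split_ifs
  · rw [abs_of_nonneg (mul_nonneg (mul_nonneg h5 (by linarith)) (by linarith)), sq]
    calc s ^ h.length * (s - 1) * (s ^ (unmatchedBins rank σ ω S h).card - 1)
        ≤ s ^ n * (s - 1) * s ^ n := by
          gcongr
          linarith
      _ = _ := by ring
  · rw [abs_of_nonpos (mul_nonpos_of_nonneg_of_nonpos h5 (by linarith)), ← mul_neg, neg_sub]
    gcongr
    exact h1.trans (le_self_pow₀ h4 (by norm_num))

theorem integral_unmatchedMartingale_cons_sub {S : Finset (Fin m)}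
    (hS : ∀ a ∈ S, ∀ b ≤ a, b ∈ S) {p : ℝ} (hp0 : 0 ≤ p) (hp1 : p < 1) (j : Fin n)
    (h : List (Finset (Fin n))) :
    ∫ E, (unmatchedMartingale rank σ ω S (1 - p)⁻¹ (neighborBins E j :: h) -
      unmatchedMartingale rank σ ω S (1 - p)⁻¹ h) ∂(randomBipartiteGraph n p) = 0 := by
  classical
  simp_rw [unmatchedMartingale_cons_sub rank σ ω hS]
  set s := (1 - p)⁻¹
  set U := unmatchedBins rank σ ω S h
  set D : Set (Set (Fin n × Fin n)) := {E | Disjoint (neighborBins E j) U}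
  set a := s ^ h.length * (s - 1) * (s ^ U.card - 1)
  set b := s ^ h.length * (1 - s)
  have hD : (randomBipartiteGraph n p).real D = (1 - p) ^ U.card :=
    measureReal_disjoint_neighborBins ⟨hp0, hp1.le⟩ j U
  have hfun : ∀ E, (if Disjoint (neighborBins E j) U then a else b) =
      D.indicator (fun _ => a - b) E + b := by
    intro E
    by_cases hE : Disjoint (neighborBins E j) U
    · rw [if_pos hE, Set.indicator_of_mem (show E ∈ D from hE)]; ring
    · rw [if_neg hE, Set.indicator_of_notMem (show E ∉ D from hE)]; ring
  simp_rw [hfun]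
  rw [integral_add Integrable.of_finite Integrable.of_finite,
    integral_indicator_const _ (Set.toFinite D).measurableSet, hD]
  -- This cancellation dictates the choice `s = (1 - p)⁻¹`: the expected gain from staying put
  -- balances the expected loss from a match.
  have hq : (1 - p) ^ U.card * s ^ U.card = 1 := by
    rw [← mul_pow, mul_inv_cancel₀ (by linarith), one_pow]
  simp only [integral_const, probReal_univ, smul_eq_mul, one_mul, a, b]
  linear_combination s ^ h.length * (s - 1) * hq

theorem measureReal_exists_unmatchedMartingale_deviation_le {S : Finset (Fin m)}
    (hS : ∀ a ∈ S, ∀ b ≤ a, b ∈ S) {p : ℝ} (hp0 : 0 ≤ p) (hp1 : p < 1) {δ : ℝ} (hδ : 0 < δ) :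
    (randomBipartiteGraph n p).real {E | ∃ t ≤ n,
      δ < |unmatchedMartingale rank σ ω S (1 - p)⁻¹ (history E t) -
        unmatchedMartingale rank σ ω S (1 - p)⁻¹ []|} ≤
      n * ((((1 - p)⁻¹) ^ n) ^ 2 * ((1 - p)⁻¹ - 1)) ^ 2 / δ ^ 2 :=
  measureReal_exists_deviation_le p _ hδ
    (fun j h _ => integral_unmatchedMartingale_cons_sub rank σ ω hS hp0 hp1 j h)
    (fun N h hl => abs_unmatchedMartingale_cons_sub_le rank σ ω hS
      ((one_le_inv₀ (by linarith)).2 (by linarith)) N h hl)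

theorem card_matchedBins_filter (S : Finset (Fin m)) (h : List (Finset (Fin n))) :
    ((matchedBins rank σ ω h).filter fun i => rank i ∈ S).card +
      (unmatchedBins rank σ ω S h).card = (binsWithRank rank S).card := by
  have : (matchedBins rank σ ω h).filter (fun i => rank i ∈ S) =
      binsWithRank rank S ∩ matchedBins rank σ ω h := by
    ext i; simp [binsWithRank, and_comm]
  rw [this, unmatchedBins, Finset.card_inter_add_card_sdiff]

theorem card_binsWithRank_div (S : Finset (Fin m)) :
    ((binsWithRank rank S).card : ℝ) / n = ∑ k ∈ S, rankFraction rank k := by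
  have h := Finset.card_eq_sum_card_fiberwise (f := rank) (s := binsWithRank rank S) (t := S)
    (fun i hi => by simpa [binsWithRank] using hi)
  rw [h]
  push_cast
  rw [Finset.sum_div]
  refine Finset.sum_congr rfl fun k hk => ?_
  rw [rankFraction, binsWithRank, Finset.filter_filter]
  congr 3
  ext i
  simp only [Finset.mem_filter, Finset.mem_univ, true_and]
  exact ⟨fun h => h.2, fun h => ⟨h ▸ hk, h⟩⟩

theorem matchedCount_add_card_unmatchedBins (E : Set (Fin n × Fin n)) (t : ℕ) (r : Fin m) :
    (matchedCount rank σ ω E t r : ℝ) =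
      ((binsWithRank rank (Finset.Iic r)).card -
        (unmatchedBins rank σ ω (Finset.Iic r) (history E t)).card) -
      ((binsWithRank rank (Finset.Iio r)).card -
        (unmatchedBins rank σ ω (Finset.Iio r) (history E t)).card) := by
  have h1 := card_matchedBins_filter rank σ ω (Finset.Iic r) (history E t)
  have h2 := card_matchedBins_filter rank σ ω (Finset.Iio r) (history E t)
  have h3 : ((matchedBins rank σ ω (history E t)).filter fun i => rank i ∈ Finset.Iic r).card =
      matchedCount rank σ ω E t r +
        ((matchedBins rank σ ω (history E t)).filter fun i => rank i ∈ Finset.Iio r).card := by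
    rw [matchedCount, ← Finset.card_union_of_disjoint]
    · congr 1
      ext i
      simp only [Finset.mem_filter, Finset.mem_Iic, Finset.mem_union, Finset.mem_Iio,
        le_iff_eq_or_lt]
      tauto
    · rw [Finset.disjoint_filter]
      intro i _ h h'
      exact (Finset.mem_Iio.1 h').ne h
  rw [← h1, ← h2, h3]
  push_cast
  ring

end Matching

/-! ### Measurability in the seed. -/

theorem measurable_matchedBins {n m : ℕ} (rank : Fin n → Fin m) {Ω : Type*} [MeasurableSpace Ω]
    (σ : TieBreaking Ω n) (h : List (Finset (Fin n))) :
    @Measurable _ _ _ ⊤ fun ω => matchedBins rank σ ω h := by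
  let : MeasurableSpace (Finset (Fin n)) := ⊤
  induction h with
  | nil => exact measurable_const
  | cons N h ih =>
    refine measurable_to_countable' fun B => ?_
    have hset : (fun ω => matchedBins rank σ ω (N :: h)) ⁻¹' {B} =
        ⋃ M : Finset (Fin n), {ω | matchedBins rank σ ω h = M} ∩
          {ω | (if hM : (N \ M).Nonempty then insert (σ.pick ω (N :: h)
            (minRankBins rank (N \ M)) (minRankBins_nonempty rank hM)) M else M) = B} := by
      ext ω
      simp [matchedBins]
    rw [hset]
    refine MeasurableSet.iUnion fun M => (ih (MeasurableSet.of_discrete (s := {M}))).inter ?_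
    by_cases hM : (N \ M).Nonempty
    · simp only [hM, dif_pos]
      exact σ.measurable_pick (N :: h) _ (minRankBins_nonempty rank hM)
        (MeasurableSet.of_discrete (s := {i | insert i M = B}))
    · simp only [hM, dif_neg, not_false_eq_true]
      exact MeasurableSet.const _

theorem measurable_matchedCount {n m : ℕ} (rank : Fin n → Fin m) {Ω : Type*}
    [MeasurableSpace Ω] (σ : TieBreaking Ω n) (t : ℕ) (r : Fin m) :
    Measurable fun x : Ω × Set (Fin n × Fin n) => matchedCount rank σ x.1 x.2 t r := by
  refine measurable_from_prod_countable_left fun E => ?_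
  let : MeasurableSpace (Finset (Fin n)) := ⊤
  exact (Measurable.of_discrete
    (f := fun B : Finset (Fin n) => (B.filter fun i => rank i = r).card)).comp
      (measurable_matchedBins rank σ (history E t))

/-! ### Inverting the martingale relation. -/

theorem abs_exp_sub_exp_le {x y B : ℝ} (hx : x ≤ B) (hy : y ≤ B) :
    |Real.exp x - Real.exp y| ≤ Real.exp B * |x - y| := by
  wlog h : y ≤ x generalizing x y
  · rw [abs_sub_comm, abs_sub_comm x]
    exact this hy hx (le_of_not_ge h)
  rw [abs_of_nonneg (sub_nonneg.2 (Real.exp_le_exp.2 h)), abs_of_nonneg (sub_nonneg.2 h)]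
  have h1 : Real.exp x - Real.exp y = Real.exp x * (1 - Real.exp (y - x)) := by
    rw [mul_sub, ← Real.exp_add]; simp
  have h2 := Real.add_one_le_exp (y - x)
  rw [h1]
  calc Real.exp x * (1 - Real.exp (y - x)) ≤ Real.exp x * (x - y) := by
        exact mul_le_mul_of_nonneg_left (by linarith) (Real.exp_pos x).le
    _ ≤ _ := by gcongr

theorem abs_log_sub_log_le {x y : ℝ} (hx : 1 ≤ x) (hy : 1 ≤ y) :
    |Real.log x - Real.log y| ≤ |x - y| := by
  wlog h : y ≤ x generalizing x y
  · rw [abs_sub_comm, abs_sub_comm x]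
    exact this hy hx (le_of_not_ge h)
  have hy0 : 0 < y := by linarith
  have hx0 : 0 < x := by linarith
  rw [abs_of_nonneg (sub_nonneg.2 (Real.log_le_log hy0 h)), abs_of_nonneg (sub_nonneg.2 h),
    ← Real.log_div hx0.ne' hy0.ne']
  calc Real.log (x / y) ≤ x / y - 1 := Real.log_le_sub_one_of_pos (by positivity)
    _ = (x - y) / y := by field_simp
    _ ≤ x - y := div_le_self (by linarith) hy

theorem one_le_one_add_exp_mul {c τ G : ℝ} (hc : 0 ≤ c) (hG : 0 ≤ G) :
    1 ≤ 1 + Real.exp (-c * τ) * (Real.exp (c * G) - 1) := by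
  have : 1 ≤ Real.exp (c * G) := Real.one_le_exp (by positivity)
  have := mul_nonneg (Real.exp_pos (-c * τ)).le (sub_nonneg.2 this)
  linarith

theorem abs_sub_log_le {c L x τ G δ : ℝ} (hc : 0 < c) (hL : c ≤ L) (hL2 : L ≤ 2 * c)
    (hx0 : 0 ≤ x) (hx1 : x ≤ 1) (hτ : 0 ≤ τ) (hτ1 : τ ≤ 1) (hG0 : 0 ≤ G) (hG1 : G ≤ 1)
    (h : |Real.exp (L * τ) * (Real.exp (L * x) - 1) - (Real.exp (L * G) - 1)| ≤ δ) :
    |x - 1 / c * Real.log (1 + Real.exp (-c * τ) * (Real.exp (c * G) - 1))| ≤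
      (δ + (1 + 2 * Real.exp (2 * c)) * (L - c)) / c := by
  set B := 1 + Real.exp (-c * τ) * (Real.exp (c * G) - 1) with hB
  have hB1 : 1 ≤ B := one_le_one_add_exp_mul hc.le hG0
  have hA1 : 1 ≤ Real.exp (L * x) := Real.one_le_exp (mul_nonneg (by linarith) hx0)
  set w := Real.exp (L * τ) * (Real.exp (L * x) - 1) with hw
  have hcancel : Real.exp (-L * τ) * Real.exp (L * τ) = 1 := by
    rw [← Real.exp_add]; simp
  -- One error comes from the martingale deviation, and two from replacing `L` by `c` in an
  -- exponential.
  have hdec : Real.exp (L * x) - B = Real.exp (-L * τ) * (w - (Real.exp (L * G) - 1)) +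
      (Real.exp (L * (G - τ)) - Real.exp (c * (G - τ))) -
      (Real.exp (-L * τ) - Real.exp (-c * τ)) := by
    have e1 : Real.exp (L * (G - τ)) = Real.exp (-L * τ) * Real.exp (L * G) := by
      rw [← Real.exp_add]; ring_nf
    have e2 : Real.exp (c * (G - τ)) = Real.exp (-c * τ) * Real.exp (c * G) := by
      rw [← Real.exp_add]; ring_nf
    rw [e1, e2, hw, hB]
    linear_combination (-(Real.exp (L * x) - 1)) * hcancel
  have hexp0 : Real.exp (-L * τ) ≤ 1 :=
    Real.exp_le_one_iff.2 (by nlinarith [mul_nonneg (hc.le.trans hL) hτ])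
  have b1 : |Real.exp (-L * τ) * (w - (Real.exp (L * G) - 1))| ≤ δ := by
    rw [abs_mul, abs_of_pos (Real.exp_pos _)]
    exact (mul_le_of_le_one_left (abs_nonneg _) hexp0).trans h
  have b2 : |Real.exp (L * (G - τ)) - Real.exp (c * (G - τ))| ≤
      Real.exp (2 * c) * (L - c) := by
    have hle : G - τ ≤ 1 := by linarith
    have hge : -1 ≤ G - τ := by linarith
    refine (abs_exp_sub_exp_le (B := 2 * c) ?_ ?_).trans ?_
    · nlinarith [mul_nonneg (hc.le.trans hL) (sub_nonneg.2 hle)]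
    · nlinarith [mul_nonneg hc.le (sub_nonneg.2 hle)]
    · rw [← sub_mul, abs_mul, abs_of_nonneg (sub_nonneg.2 hL)]
      gcongr
      exact mul_le_of_le_one_right (sub_nonneg.2 hL) (abs_le.2 ⟨hge, hle⟩)
  have b3 : |Real.exp (-L * τ) - Real.exp (-c * τ)| ≤ Real.exp (2 * c) * (L - c) := by
    refine (abs_exp_sub_exp_le (B := 2 * c) ?_ ?_).trans ?_
    · nlinarith [mul_nonneg (hc.le.trans hL) hτ]
    · nlinarith [mul_nonneg hc.le hτ]
    · rw [← sub_mul, abs_mul, abs_of_nonneg hτ, show -L - -c = -(L - c) by ring, abs_neg,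
        abs_of_nonneg (sub_nonneg.2 hL)]
      gcongr
      exact mul_le_of_le_one_right (sub_nonneg.2 hL) hτ1
  have hAB : |Real.exp (L * x) - B| ≤ δ + 2 * Real.exp (2 * c) * (L - c) := by
    rw [hdec]
    refine (abs_sub _ _).trans ((add_le_add_left (abs_add_le _ _) _).trans ?_)
    linarith
  have hlog := (abs_log_sub_log_le hA1 hB1).trans hAB
  rw [Real.log_exp] at hlog
  have hLx : |(c - L) * x| ≤ L - c := by
    rw [abs_mul, abs_of_nonneg hx0, abs_sub_comm, abs_of_nonneg (sub_nonneg.2 hL)]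
    exact mul_le_of_le_one_right (sub_nonneg.2 hL) hx1
  have hfin : |c * x - Real.log B| ≤ δ + (1 + 2 * Real.exp (2 * c)) * (L - c) := by
    have : c * x - Real.log B = (c - L) * x + (L * x - Real.log B) := by ring
    rw [this]
    refine (abs_add_le _ _).trans ?_
    linarith
  have hdiv : x - 1 / c * Real.log B = (c * x - Real.log B) / c := by field_simp
  rw [hdiv, abs_div, abs_of_pos hc]
  gcongr

theorem inv_one_sub_pow_eq_exp {n : ℕ} (hn : n ≠ 0) {p : ℝ} (hp : p < 1) (k : ℕ) :
    ((1 - p)⁻¹) ^ k = Real.exp (-(n * Real.log (1 - p)) * (k / n)) := by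
  have hn' : (n : ℝ) ≠ 0 := by exact_mod_cast hn
  rw [← Real.exp_log (inv_pos.2 (sub_pos.2 hp)), ← Real.exp_nat_mul, Real.log_inv]
  congr 1
  field_simp

/-! ### From the martingale to the matched counts. -/

section

variable {n m : ℕ} (rank : Fin n → Fin m) {Ω : Type*} [MeasurableSpace Ω] (σ : TieBreaking Ω n)
  (ω : Ω)

theorem abs_card_unmatchedBins_div_sub_log_le (hn : n ≠ 0) {c p L δ : ℝ} (hc : 0 < c)
    (hp : p < 1) (hL : L = -(n * Real.log (1 - p))) (hcL : c ≤ L) (hL2 : L ≤ 2 * c)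
    (S : Finset (Fin m)) (E : Set (Fin n × Fin n)) {t : ℕ} (ht : t ≤ n)
    (h : |unmatchedMartingale rank σ ω S (1 - p)⁻¹ (history E t) -
      unmatchedMartingale rank σ ω S (1 - p)⁻¹ []| ≤ δ) :
    |((unmatchedBins rank σ ω S (history E t)).card : ℝ) / n - 1 / c * Real.log
      (1 + Real.exp (-c * (t / n)) * (Real.exp (c * ∑ k ∈ S, rankFraction rank k) - 1))| ≤
      (δ + (1 + 2 * Real.exp (2 * c)) * (L - c)) / c := by
  have hn0 : (0 : ℝ) < n := by exact_mod_cast Nat.pos_of_ne_zero hn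
  have hfrac : ∀ k : ℕ, k ≤ n → (k : ℝ) / n ≤ 1 := fun k hk =>
    (div_le_one hn0).2 (by exact_mod_cast hk)
  have hS : (binsWithRank rank S).card ≤ n :=
    (Finset.card_le_univ _).trans_eq (Fintype.card_fin n)
  rw [← card_binsWithRank_div]
  refine abs_sub_log_le hc hcL hL2 (by positivity)
    (hfrac _ (card_unmatchedBins_le rank σ ω S _)) (by positivity) (hfrac _ ht) (by positivity)
    (hfrac _ hS) ?_
  simp only [unmatchedMartingale, unmatchedBins_nil, length_history E ht, List.length_nil,
    inv_one_sub_pow_eq_exp hn hp, ← hL] at h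
  simpa using h

theorem abs_matchedCount_div_sub_limitFraction_le (hn : n ≠ 0) {c p L δ : ℝ} (hc : 0 < c)
    (hp : p < 1) (hL : L = -(n * Real.log (1 - p))) (hcL : c ≤ L) (hL2 : L ≤ 2 * c)
    (E : Set (Fin n × Fin n)) {t : ℕ} (ht : t ≤ n) (r : Fin m)
    (h1 : |unmatchedMartingale rank σ ω (Finset.Iic r) (1 - p)⁻¹ (history E t) -
      unmatchedMartingale rank σ ω (Finset.Iic r) (1 - p)⁻¹ []| ≤ δ)
    (h2 : |unmatchedMartingale rank σ ω (Finset.Iio r) (1 - p)⁻¹ (history E t) -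
      unmatchedMartingale rank σ ω (Finset.Iio r) (1 - p)⁻¹ []| ≤ δ) :
    |(matchedCount rank σ ω E t r : ℝ) / n -
      limitFraction c (rankFraction rank) r ((t : ℝ) / n)| ≤
      2 * ((δ + (1 + 2 * Real.exp (2 * c)) * (L - c)) / c) := by
  have e1 := abs_card_unmatchedBins_div_sub_log_le rank σ ω hn hc hp hL hcL hL2 _ E ht h1
  have e2 := abs_card_unmatchedBins_div_sub_log_le rank σ ω hn hc hp hL hcL hL2 _ E ht h2
  have hg : ∀ k, 0 ≤ rankFraction rank k := fun k => by unfold rankFraction; positivity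
  have p1 := one_le_one_add_exp_mul (τ := (t : ℝ) / n) hc.le
    (Finset.sum_nonneg fun k (_ : k ∈ Finset.Iic r) => hg k)
  have p2 := one_le_one_add_exp_mul (τ := (t : ℝ) / n) hc.le
    (Finset.sum_nonneg fun k (_ : k ∈ Finset.Iio r) => hg k)
  have hsum : ∑ k ∈ Finset.Iic r, rankFraction rank k =
      rankFraction rank r + ∑ k ∈ Finset.Iio r, rankFraction rank k := by
    rw [← Finset.Iio_insert, Finset.sum_insert (by simp)]
  rw [limitFraction, Real.log_div (by linarith) (by linarith),
    matchedCount_add_card_unmatchedBins, sub_div, sub_div, sub_div, card_binsWithRank_div,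
    card_binsWithRank_div]
  rw [abs_le] at e1 e2 ⊢
  constructor <;> linarith [e1.1, e1.2, e2.1, e2.2]

theorem measure_exists_lt_abs_le (hn : n ≠ 0) {c p L δ ε : ℝ} (hc : 0 < c)
    (hp0 : 0 ≤ p) (hp : p < 1) (hL : L = -(n * Real.log (1 - p))) (hcL : c ≤ L)
    (hL2 : L ≤ 2 * c) (hδ : 0 < δ)
    (hε : 2 * ((δ + (1 + 2 * Real.exp (2 * c)) * (L - c)) / c) ≤ ε) :
    (randomBipartiteGraph n p) {E | ∃ t ≤ n, ∃ r : Fin m,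
      ε < |(matchedCount rank σ ω E t r : ℝ) / n -
        limitFraction c (rankFraction rank) r ((t : ℝ) / n)|} ≤
      ENNReal.ofReal (m * (2 * (n * ((((1 - p)⁻¹) ^ n) ^ 2 * ((1 - p)⁻¹ - 1)) ^ 2 / δ ^ 2))) := by
  set μ := randomBipartiteGraph n p
  set b := n * ((((1 - p)⁻¹) ^ n) ^ 2 * ((1 - p)⁻¹ - 1)) ^ 2 / δ ^ 2
  let bad : Finset (Fin m) → Set (Set (Fin n × Fin n)) := fun S => {E | ∃ t ≤ n,
    δ < |unmatchedMartingale rank σ ω S (1 - p)⁻¹ (history E t) -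
      unmatchedMartingale rank σ ω S (1 - p)⁻¹ []|}
  have hsub : {E : Set (Fin n × Fin n) | ∃ t ≤ n, ∃ r : Fin m,
      ε < |(matchedCount rank σ ω E t r : ℝ) / n -
        limitFraction c (rankFraction rank) r ((t : ℝ) / n)|} ⊆
      ⋃ r : Fin m, (bad (Finset.Iic r) ∪ bad (Finset.Iio r)) := by
    rintro E ⟨t, ht, r, hr⟩
    by_contra hE
    simp only [bad, Set.mem_iUnion, Set.mem_union, Set.mem_ofPred_eq, not_exists, not_or, not_and,
      not_lt] at hE
    exact hr.not_ge ((abs_matchedCount_div_sub_limitFraction_le rank σ ω hn hc hp hL hcL hL2 E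
      ht r ((hE r).1 t ht) ((hE r).2 t ht)).trans hε)
  rw [← ofReal_measureReal]
  refine ENNReal.ofReal_le_ofReal ((measureReal_mono hsub).trans ?_)
  refine (measureReal_iUnion_fintype_le _).trans ?_
  have hbound : ∀ r : Fin m, μ.real (bad (Finset.Iic r) ∪ bad (Finset.Iio r)) ≤ 2 * b := by
    intro r
    refine (measureReal_union_le _ _).trans ?_
    rw [two_mul]
    refine add_le_add ?_ ?_
    · exact measureReal_exists_unmatchedMartingale_deviation_le rank σ ω
        (fun a ha b hb => Finset.mem_Iic.2 (hb.trans (Finset.mem_Iic.1 ha))) hp0 hp hδ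
    · exact measureReal_exists_unmatchedMartingale_deviation_le rank σ ω
        (fun a ha b hb => Finset.mem_Iio.2 (hb.trans_lt (Finset.mem_Iio.1 ha))) hp0 hp hδ
  refine (Finset.sum_le_sum fun r _ => hbound r).trans ?_
  simp

/-- A bound valid for every fixed seed passes to the product measure by Fubini, since seed and graph
are independent. -/
theorem one_sub_ofReal_le_measure (ν : Measure Ω) [IsProbabilityMeasure ν] {c p ε B : ℝ}
    (h : ∀ ω, (randomBipartiteGraph n p) {E | ∃ t ≤ n, ∃ r : Fin m,
      ε < |(matchedCount rank σ ω E t r : ℝ) / n -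
        limitFraction c (rankFraction rank) r ((t : ℝ) / n)|} ≤ ENNReal.ofReal B) :
    1 - ENNReal.ofReal B ≤ (ν.prod (randomBipartiteGraph n p))
      {x : Ω × Set (Fin n × Fin n) | ∀ t ≤ n, ∀ r : Fin m,
        |(matchedCount rank σ x.1 x.2 t r : ℝ) / n
          - limitFraction c (rankFraction rank) r ((t : ℝ) / n)| ≤ ε} := by
  set A := {x : Ω × Set (Fin n × Fin n) | ∀ t ≤ n, ∀ r : Fin m,
        |(matchedCount rank σ x.1 x.2 t r : ℝ) / n
          - limitFraction c (rankFraction rank) r ((t : ℝ) / n)| ≤ ε} with hA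
  have hmeas : MeasurableSet A := by
    simp only [hA, Set.ofPred_forall]
    refine MeasurableSet.iInter fun t => MeasurableSet.iInter fun _ => MeasurableSet.iInter
      fun r => ?_
    exact measurable_matchedCount rank σ t r (MeasurableSet.of_discrete
      (s := {k : ℕ | |(k : ℝ) / n - limitFraction c (rankFraction rank) r ((t : ℝ) / n)| ≤ ε}))
  have hc : (ν.prod (randomBipartiteGraph n p)) Aᶜ ≤ ENNReal.ofReal B := by
    rw [Measure.prod_apply hmeas.compl]
    refine (lintegral_mono (g := fun _ => ENNReal.ofReal B) fun ω => ?_).trans (by simp)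
    refine (measure_mono ?_).trans (h ω)
    intro E hE
    simpa [hA] using hE
  rw [prob_compl_eq_one_sub hmeas] at hc
  exact tsub_le_iff_left.2 (tsub_le_iff_right.1 hc)

end

/-! ### The limit `n → ∞`. -/

theorem le_neg_mul_log_one_sub_div {c : ℝ} {n : ℕ} (hn : n ≠ 0) (h : c / n < 1) :
    c ≤ -(n * Real.log (1 - c / n)) := by
  have hn0 : (0 : ℝ) < n := by exact_mod_cast Nat.pos_of_ne_zero hn
  have h1 := Real.log_le_sub_one_of_pos (sub_pos.2 h)
  have h2 : n * Real.log (1 - c / n) ≤ n * (-(c / n)) := by gcongr; linarith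
  have h3 : n * (-(c / n)) = -c := by field_simp
  linarith

theorem tendsto_neg_mul_log_one_sub_div (c : ℝ) :
    Tendsto (fun n : ℕ => -(n * Real.log (1 - c / n))) atTop (𝓝 c) := by
  have h := ((Real.tendsto_mul_log_one_add_div_atTop (-c)).comp
    tendsto_natCast_atTop_atTop).neg
  simp only [neg_neg] at h
  refine h.congr fun n => ?_
  simp [Function.comp, neg_div, sub_eq_add_neg]

theorem theorem5 (m : ℕ) (c : ℝ) (hc : 0 < c)
    (rank : ∀ n : ℕ, Fin n → Fin m)
    {Ω : ℕ → Type*} [∀ n, MeasurableSpace (Ω n)]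
    (ν : ∀ n, Measure (Ω n)) [∀ n, IsProbabilityMeasure (ν n)]
    (σ : ∀ n, TieBreaking (Ω n) n)
    (ε : ℝ) (hε : 0 < ε) :
    Tendsto
      (fun n : ℕ => ((ν n).prod (randomBipartiteGraph n (c / n)))
        {x : Ω n × Set (Fin n × Fin n) | ∀ t ≤ n, ∀ r : Fin m,
          |(matchedCount (rank n) (σ n) x.1 x.2 t r : ℝ) / n
            - limitFraction c (rankFraction (rank n)) r ((t : ℝ) / n)| ≤ ε})
      atTop (𝓝 1) := by
  -- The deviation `δ` and the error from `L ≠ c` each get `c * ε / 4`; the final factor `2 / c`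
  -- turns their sum into `ε`.
  set δ := c * ε / 4 with hδ_def
  have hδ : 0 < δ := by positivity
  set C := m * (2 * ((Real.exp (2 * c) ^ 2 * (2 * c)) ^ 2 / δ ^ 2)) with hC
  have hlower : Tendsto (fun n : ℕ => 1 - ENNReal.ofReal (C / n)) atTop (𝓝 1) := by
    have h1 : Tendsto (fun n : ℕ => ENNReal.ofReal (C / n)) atTop (𝓝 0) := by
      simpa using ENNReal.tendsto_ofReal (tendsto_const_div_atTop_nhds_zero_nat C)
    simpa using ENNReal.Tendsto.sub tendsto_const_nhds h1 (Or.inl ENNReal.one_ne_top)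
  refine tendsto_of_tendsto_of_tendsto_of_le_of_le' hlower tendsto_const_nhds ?_
    (Eventually.of_forall fun n => prob_le_one)
  have hL := tendsto_neg_mul_log_one_sub_div c
  have hclose : ∀ᶠ n : ℕ in atTop,
      (1 + 2 * Real.exp (2 * c)) * (-(n * Real.log (1 - c / n)) - c) ≤ c * ε / 4 := by
    have h := (hL.sub_const c).const_mul (1 + 2 * Real.exp (2 * c))
    rw [sub_self, mul_zero] at h
    exact h.eventually_le_const hδ
  -- `L ≤ 2 * c` bounds `s ^ n` by `exp (2 * c)`, and `n ≥ 2 * c` gives `p ≤ 1 / 2`, hence `s - 1 ≤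
  -- 2 * p`.
  filter_upwards [hclose, hL.eventually_le_const (show c < 2 * c by linarith),
    eventually_ne_atTop 0, tendsto_natCast_atTop_atTop.eventually_ge_atTop (2 * c)]
    with n hn1 hn2 hn0 hn3
  have hnpos : (0 : ℝ) < n := by exact_mod_cast Nat.pos_of_ne_zero hn0
  set p := c / n with hp_def
  have hp0 : 0 ≤ p := by positivity
  have hp2 : p ≤ 1 / 2 := by rw [hp_def, div_le_iff₀ hnpos]; linarith
  have hp1 : p < 1 := by linarith
  refine one_sub_ofReal_le_measure (rank n) (σ n) (ν n) fun ω => ?_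
  refine (measure_exists_lt_abs_le (rank n) (σ n) ω hn0 hc hp0 hp1 rfl
    (le_neg_mul_log_one_sub_div hn0 hp1) hn2 hδ ?_).trans (ENNReal.ofReal_le_ofReal ?_)
  · rw [mul_div_assoc', div_le_iff₀ hc]
    linarith
  · have hs1 : (1 - p)⁻¹ - 1 ≤ 2 * c / n := by
      have : (1 - p)⁻¹ - 1 = p / (1 - p) := by
        have : 1 - p ≠ 0 := by linarith
        field_simp
        ring
      rw [this, div_le_iff₀ (by linarith), mul_div_assoc, ← hp_def]
      nlinarith
    have hs0 : 0 ≤ (1 - p)⁻¹ - 1 :=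
      sub_nonneg.2 ((one_le_inv₀ (by linarith)).2 (by linarith))
    have hsn : ((1 - p)⁻¹) ^ n ≤ Real.exp (2 * c) := by
      rw [inv_one_sub_pow_eq_exp hn0 hp1, div_self hnpos.ne', mul_one]
      exact Real.exp_le_exp.2 hn2
    have hsn0 : 0 ≤ ((1 - p)⁻¹) ^ n := pow_nonneg (by linarith) n
    calc m * (2 * (n * ((((1 - p)⁻¹) ^ n) ^ 2 * ((1 - p)⁻¹ - 1)) ^ 2 / δ ^ 2))
        ≤ m * (2 * (n * (Real.exp (2 * c) ^ 2 * (2 * c / n)) ^ 2 / δ ^ 2)) := by gcongr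
      _ = C / n := by rw [hC]; field_simp
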